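/- Let $G$ be a locally compact (Hausdorff) Abelian group, written additively, and let $\mathcal C(G)$ be the space of continuous functions $G\to\mathbb C$ with the topology of uniform convergence on compact sets. Let $\mathcal M_c(G)$ be the space of compactly supported complex (Radon) measures on $G$, identified with the topological dual of $\mathcal C(G)$, with the weak* topology and with convolution $\langle\mu*\nu,f\rangle=\int\int f(x+y)\,d\mu(x)\,d\nu(y)$ as product. An exponential on $G$ is a continuous homomorphism $m:G\to\mathbb C\setminus\{0\}$ into the multiplicative group, and the Fourier--Laplace transform of $\mu\in\mathcal M_c(G)$ is the function $\widehat\mu(m)=\int m(-x)\,d\mu(x)$ on the set of exponentials. Let $\mathcal A(G)=\{\widehat\mu:\mu\in\mathcal M_c(G)\}$ be the Fourier algebra, with pointwise multiplication; it is identified, as a topological algebra, with $\mathcal M_c(G)$ via $\mu\mapsto\widehat\mu$. For an exponential $m$ let $\widehat M_m=\{\widehat\mu\in\mathcal A(G):\widehat\mu(m)=0\}$, and let $\widehat M_m^{\,n+1}$ denote the closed power of this ideal, i.e. the closure in $\mathcal A(G)$ of the ideal generated by all products of $n+1$ elements of $\widehat M_m$. Derivations of $\mathcal A(G)$ are continuous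 linear operators $D:\mathcal A(G)\to\mathcal A(G)$ defined as follows. Those of order $0$ are the constant multiples of the identity. $D$ is a derivation of order $1$ if $D(ab)=D(a)b+aD(b)$ for all $a,b$. For $k\ge 1$, $D$ is a derivation of order $k+1$ if the operator $(a,b)\mapsto D(ab)-D(a)b-aD(b)$ is a derivation of order $k$ in each of the variables $a$ and $b$ separately (zero operators being admitted in every order). $D$ is a derivation of order at most $n$ if it is a derivation of order $k$ for some $0\le k\le n$. Then for every exponential $m$ on $G$, every natural number $n\ge 0$ and every $\widehat\mu\in\mathcal A(G)$: $\widehat\mu\in\widehat M_m^{\,n+1}$ if and only if $D(\widehat\mu)(m)=0$ for every derivation $D$ of $\mathcal A(G)$ of order at most $n$. -/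

import Mathlib

/-!
Throughout, `G` is a locally compact (Hausdorff) abelian group, written additively, and `C(G, ℂ)`
carries the topology of uniform convergence on compact sets (the compact-open topology).
-/

/-- The compactly supported complex (Radon) measures on `G`, as the topological dual of `C(G, ℂ)`,
with the weak-* topology. We write `μ f` for `∫ f dμ`. With convolution as product this is also
the Fourier algebra of `G`, its elements being identified with their Fourier-Laplace transforms
(see `fourierLaplace` below). -/
def MeasureAlgebra (G : Type*) [TopologicalSpace G] : Type _ := WeakDual ℂ C(G, ℂ)

namespace MeasureAlgebra

section Basic

variable {G : Type*} [TopologicalSpace G]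

noncomputable instance instAddCommGroup : AddCommGroup (MeasureAlgebra G) :=
  inferInstanceAs (AddCommGroup (WeakDual ℂ C(G, ℂ)))

noncomputable instance : Module ℂ (MeasureAlgebra G) :=
  inferInstanceAs (Module ℂ (WeakDual ℂ C(G, ℂ)))

/-- The weak-* topology: the coarsest one for which all `μ ↦ ∫ f dμ`, `f ∈ C(G)`, are
continuous. -/
instance : TopologicalSpace (MeasureAlgebra G) :=
  inferInstanceAs (TopologicalSpace (WeakDual ℂ C(G, ℂ)))

noncomputable instance : FunLike (MeasureAlgebra G) C(G, ℂ) ℂ :=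
  inferInstanceAs (FunLike (WeakDual ℂ C(G, ℂ)) C(G, ℂ) ℂ)

/-- A continuous linear functional on `C(G, ℂ)`, regarded as a measure. -/
noncomputable def ofCLM (φ : C(G, ℂ) →L[ℂ] ℂ) : MeasureAlgebra G := φ

/-- A measure, regarded as a continuous linear functional on `C(G, ℂ)`. -/
noncomputable def toCLM (μ : MeasureAlgebra G) : C(G, ℂ) →L[ℂ] ℂ := μ

@[simp] theorem ofCLM_apply (φ : C(G, ℂ) →L[ℂ] ℂ) (f : C(G, ℂ)) : ofCLM φ f = φ f := rfl

@[simp] theorem toCLM_apply (μ : MeasureAlgebra G) (f : C(G, ℂ)) : μ.toCLM f = μ f := rfl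

@[ext] theorem ext {μ ν : MeasureAlgebra G} (h : ∀ f, μ f = ν f) : μ = ν := DFunLike.ext _ _ h

@[simp] theorem add_apply (μ ν : MeasureAlgebra G) (f : C(G, ℂ)) : (μ + ν) f = μ f + ν f := rfl

@[simp] theorem zero_apply (f : C(G, ℂ)) : (0 : MeasureAlgebra G) f = 0 := rfl

@[simp] theorem smul_apply (c : ℂ) (μ : MeasureAlgebra G) (f : C(G, ℂ)) :
    (c • μ) f = c * μ f := rfl

theorem map_add' (μ : MeasureAlgebra G) (f g : C(G, ℂ)) : μ (f + g) = μ f + μ g :=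
  map_add μ.toCLM f g

theorem map_smul' (μ : MeasureAlgebra G) (c : ℂ) (f : C(G, ℂ)) : μ (c • f) = c * μ f :=
  map_smul μ.toCLM c f

theorem map_zero' (μ : MeasureAlgebra G) : μ 0 = 0 :=
  map_zero μ.toCLM

/-- The point mass at `x`. -/
noncomputable def dirac (x : G) : MeasureAlgebra G :=
  ofCLM
    { toFun := fun f => f x
      map_add' := fun _ _ => rfl
      map_smul' := fun _ _ => rfl
      cont := continuous_eval_const x }

@[simp] theorem dirac_apply (x : G) (f : C(G, ℂ)) : dirac x f = f x := rfl

end Basic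

section Convolution

set_option linter.unusedSectionVars false

variable {G : Type*} [TopologicalSpace G] [LocallyCompactSpace G]

/-- Partial integration: `F ↦ (x ↦ ∫ F(x, y) dν(y))`. -/
noncomputable def partialInt (ν : MeasureAlgebra G) : C(G × G, ℂ) →L[ℂ] C(G, ℂ) where
  toFun F := ⟨fun x => ν (F.curry x), ν.toCLM.continuous.comp F.curry.continuous⟩
  map_add' F H := by ext x; exact ν.map_add' (F.curry x) (H.curry x)
  map_smul' c F := by ext x; exact ν.map_smul' c (F.curry x)
  cont := by
    refine ContinuousMap.continuous_of_continuous_uncurry _ ?_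
    have h : Continuous fun p : C(G × G, ℂ) × G => p.1.curry p.2 :=
      ContinuousEval.continuous_eval.comp
        ((ContinuousMap.continuous_curry.comp continuous_fst).prodMk continuous_snd)
    exact ν.toCLM.continuous.comp h

@[simp] theorem partialInt_apply (ν : MeasureAlgebra G) (F : C(G × G, ℂ)) (x : G) :
    ν.partialInt F x = ν (F.curry x) := rfl

/-- The flip `F(x, y) ↦ F(y, x)`. -/
noncomputable def flip (F : C(G × G, ℂ)) : C(G × G, ℂ) := F.comp ⟨Prod.swap, continuous_swap⟩

/-- A continuous linear functional on `C(G × G, ℂ)` that vanishes on all products `g(x) h(y)` of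
real functions is zero. -/
theorem eq_zero_of_prod [T2Space G] (L : C(G × G, ℂ) →L[ℂ] ℂ)
    (hL : ∀ g h : C(G, ℝ), L ⟨fun p => ((g p.1 * h p.2 : ℝ) : ℂ), by fun_prop⟩ = 0) : L = 0 := by
  let I : C(G × G, ℝ) →L[ℝ] C(G × G, ℂ) := Complex.ofRealCLM.compLeftContinuous ℝ (G × G)
  let P : Submonoid C(G × G, ℝ) :=
    { carrier := {F | ∃ g h : C(G, ℝ), F = g.comp ContinuousMap.fst * h.comp ContinuousMap.snd}
      one_mem' := ⟨1, 1, by ext; simp⟩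
      mul_mem' := by
        rintro _ _ ⟨g, h, rfl⟩ ⟨g', h', rfl⟩
        exact ⟨g * g', h * h', by ext; simp; ring⟩ }
  let S : Subalgebra ℝ C(G × G, ℝ) := Algebra.adjoin ℝ (P : Set C(G × G, ℝ))
  have hS : ∀ F ∈ S, L (I F) = 0 := by
    intro F hF
    have hF' : F ∈ Submodule.span ℝ (P : Set C(G × G, ℝ)) := by
      have := (Subalgebra.mem_toSubmodule (S := S)).2 hF
      rwa [Algebra.adjoin_eq_span, Submonoid.closure_eq] at this
    have hle : Submodule.span ℝ (P : Set C(G × G, ℝ)) ≤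
        LinearMap.ker ((L.restrictScalars ℝ).toLinearMap ∘ₗ I.toLinearMap) := by
      rw [Submodule.span_le]
      rintro _ ⟨g, h, rfl⟩
      exact hL g h
    exact hle hF'
  have hsep : S.SeparatesPoints := by
    rintro ⟨x, y⟩ ⟨x', y'⟩ hne
    have key : ∀ a b : G, a ≠ b → ∃ g : C(G, ℝ), g a ≠ g b := by
      intro a b hab
      obtain ⟨g, hg0, hg1, -⟩ := exists_continuous_zero_one_of_isCompact
        (isCompact_singleton (x := a)) (isClosed_singleton (x := b)) (by simpa using hab)
      refine ⟨g, ?_⟩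
      rw [hg0 rfl, hg1 rfl]
      simp
    by_cases hx : x = x'
    · have hy : y ≠ y' := fun hy => hne (by rw [hx, hy])
      obtain ⟨g, hg⟩ := key y y' hy
      refine ⟨_, ⟨g.comp ContinuousMap.snd, Algebra.subset_adjoin ⟨1, g, by ext; simp⟩, rfl⟩, ?_⟩
      simpa using hg
    · obtain ⟨g, hg⟩ := key x x' hx
      refine ⟨_, ⟨g.comp ContinuousMap.fst, Algebra.subset_adjoin ⟨g, 1, by ext; simp⟩, rfl⟩, ?_⟩
      simpa using hg
  have hdense : ∀ F : C(G × G, ℝ), F ∈ closure (S : Set C(G × G, ℝ)) := by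
    intro F
    rw [mem_closure_iff_nhds_basis (nhds_basis_uniformity'
      (Metric.uniformity_basis_dist.compactConvergenceUniformity (α := G × G)))]
    rintro ⟨K, ε⟩ ⟨hK, hε⟩
    obtain ⟨g, hg, hgF⟩ :=
      ContinuousMap.exists_mem_subalgebra_near_continuous_of_isCompact_of_separatesPoints
        hsep F hK hε
    refine ⟨g, hg, fun x hx => ?_⟩
    have := hgF x hx
    rw [← dist_eq_norm, dist_comm] at this
    exact this
  have hreal : ∀ F : C(G × G, ℝ), L (I F) = 0 := by
    intro F
    have hcl : IsClosed {F : C(G × G, ℝ) | L (I F) = 0} :=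
      isClosed_eq (L.continuous.comp I.continuous) continuous_const
    exact closure_minimal (fun F hF => hS F hF) hcl (hdense F)
  ext F
  have hF : F = I ⟨fun p => (F p).re, by fun_prop⟩
      + Complex.I • I ⟨fun p => (F p).im, by fun_prop⟩ := by
    ext p
    change F p = ((F p).re : ℂ) + Complex.I * ((F p).im : ℂ)
    rw [mul_comm, Complex.re_add_im]
  rw [hF, map_add, map_smul, hreal, hreal]
  simp

/-- Fubini's theorem for compactly supported measures. -/
theorem fubini [T2Space G] (μ ν : MeasureAlgebra G) (F : C(G × G, ℂ)) :
    μ (ν.partialInt F) = ν (μ.partialInt (flip F)) := by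
  let flipL : C(G × G, ℂ) →L[ℂ] C(G × G, ℂ) :=
    { toFun := flip
      map_add' := fun _ _ => rfl
      map_smul' := fun _ _ => rfl
      cont := ContinuousMap.continuous_precomp _ }
  have h := eq_zero_of_prod
    (μ.toCLM ∘L ν.partialInt - ν.toCLM ∘L μ.partialInt ∘L flipL) (fun g h => by
      let g' : C(G, ℂ) := ⟨fun x => (g x : ℂ), by fun_prop⟩
      let h' : C(G, ℂ) := ⟨fun x => (h x : ℂ), by fun_prop⟩
      let F : C(G × G, ℂ) := ⟨fun p => ((g p.1 * h p.2 : ℝ) : ℂ), by fun_prop⟩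
      have h1 : ν.partialInt F = ν h' • g' := by
        ext x
        have h2 : F.curry x = g' x • h' := by
          ext y
          exact Complex.ofReal_mul _ _
        rw [partialInt_apply, h2, map_smul', mul_comm]
        rfl
      have h3 : μ.partialInt (flip F) = μ g' • h' := by
        ext y
        have h4 : (flip F).curry y = h' y • g' := by
          ext x
          exact (Complex.ofReal_mul _ _).trans (mul_comm _ _)
        rw [partialInt_apply, h4, map_smul', mul_comm]
        rfl
      change μ (ν.partialInt F) - ν (μ.partialInt (flip F)) = 0
      rw [h1, h3, map_smul', map_smul', mul_comm, sub_self])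
  exact sub_eq_zero.1 (congrArg (fun L : C(G × G, ℂ) →L[ℂ] ℂ => L F) h)

variable [AddCommGroup G] [IsTopologicalAddGroup G]

/-- `f ↦ ((x, y) ↦ f (x + y))`. -/
noncomputable def pullAdd : C(G, ℂ) →L[ℂ] C(G × G, ℂ) where
  toFun f := f.comp ⟨fun p => p.1 + p.2, continuous_add⟩
  map_add' _ _ := rfl
  map_smul' _ _ := rfl
  cont := ContinuousMap.continuous_precomp _

/-- Convolution: `∫ f d(μ * ν) = ∫ ∫ f (x + y) dν(y) dμ(x)`. -/
noncomputable instance : Mul (MeasureAlgebra G) :=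
  ⟨fun μ ν => ofCLM (μ.toCLM ∘L ν.partialInt ∘L pullAdd)⟩

theorem mul_apply (μ ν : MeasureAlgebra G) (f : C(G, ℂ)) :
    (μ * ν) f = μ (ν.partialInt (pullAdd f)) := rfl

/-- The unit of convolution is the point mass at `0`. -/
noncomputable instance : One (MeasureAlgebra G) := ⟨dirac 0⟩

theorem one_apply (f : C(G, ℂ)) : (1 : MeasureAlgebra G) f = f 0 := rfl

variable [T2Space G]

theorem mul_comm' (μ ν : MeasureAlgebra G) : μ * ν = ν * μ := by
  ext f
  rw [mul_apply, mul_apply, fubini]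
  congr 2
  ext p
  exact congrArg f (add_comm _ _)

theorem one_mul' (μ : MeasureAlgebra G) : 1 * μ = μ := by
  ext f
  rw [mul_apply, one_apply, partialInt_apply]
  congr 1
  ext y
  exact congrArg f (zero_add _)

theorem mul_assoc' (μ ν ρ : MeasureAlgebra G) : μ * ν * ρ = μ * (ν * ρ) := by
  ext f
  rw [mul_apply, mul_apply, mul_apply]
  congr 1
  ext a
  rw [partialInt_apply, partialInt_apply, mul_apply]
  congr 1
  ext b
  change ρ _ = ρ _
  congr 1
  ext c
  exact congrArg f (add_assoc _ _ _)

theorem right_distrib' (μ ν ρ : MeasureAlgebra G) : (μ + ν) * ρ = μ * ρ + ν * ρ := rfl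

theorem left_distrib' (μ ν ρ : MeasureAlgebra G) : μ * (ν + ρ) = μ * ν + μ * ρ := by
  rw [mul_comm', right_distrib', mul_comm' ν, mul_comm' ρ]

noncomputable instance : CommRing (MeasureAlgebra G) where
  toAddCommGroup := instAddCommGroup
  mul_comm := mul_comm'
  one_mul := one_mul'
  mul_one μ := by rw [mul_comm', one_mul']
  mul_assoc := mul_assoc'
  left_distrib := left_distrib'
  right_distrib := right_distrib'
  zero_mul _ := rfl
  mul_zero μ := by rw [mul_comm']; rfl

noncomputable instance : Algebra ℂ (MeasureAlgebra G) :=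
  Algebra.ofModule (fun _ _ _ => rfl) (fun c μ ν => by
    rw [mul_comm', mul_comm' μ ν]; rfl)

end Convolution

end MeasureAlgebra

/-- The exponentials of `G`: continuous homomorphisms into the nonzero complex numbers. -/
abbrev Exponential (G : Type*) [TopologicalSpace G] [AddCommGroup G] : Type _ :=
  Multiplicative G →ₜ* ℂˣ

/-- `x ↦ m (-x)`, as a continuous function on `G`. -/
noncomputable def Exponential.check {G : Type*} [TopologicalSpace G] [AddCommGroup G] [IsTopologicalAddGroup G]
    (m : Exponential G) : C(G, ℂ) where
  toFun x := (m (Multiplicative.ofAdd (-x)) : ℂ)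
  continuous_toFun := Units.continuous_val.comp
    ((ContinuousMonoidHom.continuous_toFun m).comp (continuous_ofAdd.comp continuous_neg))

section FourierAlgebra

variable {G : Type*} [AddCommGroup G] [TopologicalSpace G] [IsTopologicalAddGroup G]
  [LocallyCompactSpace G] [T2Space G]

open MeasureAlgebra in
/-- The Fourier-Laplace transform `μ̂ (m) = ∫ m (-x) dμ(x)`, which turns convolution into the
pointwise product of functions on the set of exponentials. -/
noncomputable def fourierLaplace : MeasureAlgebra G →ₐ[ℂ] (Exponential G → ℂ) :=
  AlgHom.ofLinearMap
    { toFun := fun μ m => μ m.check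
      map_add' := fun _ _ => rfl
      map_smul' := fun _ _ => rfl }
    (by
      funext m
      change m.check 0 = 1
      simp [Exponential.check])
    (fun μ ν => by
      funext m
      change (μ * ν) m.check = μ m.check * ν m.check
      have h : ν.partialInt (pullAdd m.check) = ν m.check • m.check := by
        ext x
        have h2 : (pullAdd m.check).curry x = m.check x • m.check := by
          ext y
          change m.check (x + y) = m.check x * m.check y
          simp [Exponential.check, ofAdd_add, mul_comm]
        rw [partialInt_apply, h2, map_smul', mul_comm]
        rfl
      rw [mul_apply, h, map_smul', mul_comm])

/-- The exponential maximal ideal of `m`: all `μ` whose transform vanishes at `m`. -/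
noncomputable def exponentialMaximalIdeal (m : Exponential G) : Ideal (MeasureAlgebra G) :=
  RingHom.ker ((Pi.evalRingHom (fun _ : Exponential G => ℂ) m).comp
    (fourierLaplace (G := G) : MeasureAlgebra G →+* (Exponential G → ℂ)))

end FourierAlgebra

section Derivation

variable {A : Type*} [CommRing A] [Algebra ℂ A]

/-- The operator `a ↦ D (a * b) - D a * b - a * D b`. -/
def leibnizDefectLeft (D : A →ₗ[ℂ] A) (b : A) : A →ₗ[ℂ] A where
  toFun a := D (a * b) - D a * b - a * D b
  map_add' x y := by simp only [add_mul, map_add]; ring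
  map_smul' c x := by
    simp only [smul_mul_assoc, map_smul, RingHom.id_apply, smul_sub]

/-- The operator `b ↦ D (a * b) - D a * b - a * D b`. -/
def leibnizDefectRight (D : A →ₗ[ℂ] A) (a : A) : A →ₗ[ℂ] A where
  toFun b := D (a * b) - D a * b - a * D b
  map_add' x y := by simp only [mul_add, map_add]; ring
  map_smul' c x := by
    simp only [mul_smul_comm, map_smul, RingHom.id_apply, smul_sub]

/-- `IsDerivationOfOrder n D`: `D` is a derivation of order `n` of the commutative topological
algebra `A`. The constant multiples of the identity have order `0`; for `n ≥ 1` the notion is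
cumulative: an operator of order `n` also has order `n + 1`, its Leibniz defect being allowed
to vanish. -/
def IsDerivationOfOrder [TopologicalSpace A] : ℕ → (A →ₗ[ℂ] A) → Prop
  | 0, D => ∃ c : ℂ, D = c • LinearMap.id
  | 1, D => Continuous D ∧ ∀ a b, D (a * b) = D a * b + a * D b
  | n + 2, D => Continuous D ∧ (∀ b, IsDerivationOfOrder (n + 1) (leibnizDefectLeft D b)) ∧
      ∀ a, IsDerivationOfOrder (n + 1) (leibnizDefectRight D a)

/-- `D` is a derivation of order at most `n`, the constant multiples of the identity included. -/
def IsDerivationOfOrderAtMost [TopologicalSpace A] (n : ℕ) (D : A →ₗ[ℂ] A) : Prop :=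
  ∃ k ≤ n, IsDerivationOfOrder k D

end Derivation

/-!
The proof rests on the duality between `MeasureAlgebra G` and `C(G, ℂ)`. Write `M` for the ideal of
all `μ` whose transform vanishes at the exponential `m`.

A derivation of order `n ≥ 1` is a continuous operator all of whose `n`-fold iterated Leibniz
defects vanish (`isDerivationOfOrder_succ_iff`). By induction such an operator maps `I ^ (n + 1)`
into `I` for every ideal `I` (`HasVanishingDefects.map_mem`), which together with continuity shows
that the condition on derivations is necessary.

For the converse, let `μ` lie outside the closure of `M ^ (n + 1)`. By the Hahn-Banach theorem there
is `f ∈ C(G, ℂ)` with `∫ f dμ ≠ 0` which is annihilated by `M ^ (n + 1)`. As `M` contains the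
measures `m(y) δ_y - δ_0`, the quotient `p = f / m.check` is annihilated by all `(n + 1)`-fold
differences: it is a generalized polynomial of degree at most `n`
(`isGenPoly_of_annihilates`). Multiplication of measures by `p - p 0` is then a derivation of order
`n`: its Leibniz defect at the point mass `δ_y` is, up to translation by `y`, multiplication by
`x ↦ p (x + y) - p x - p y + p 0`, which has smaller degree, and the point masses span a dense
subspace (`hasVanishingDefects_mulFun`). Since
`f = (p - p 0) * m.check + p 0 • m.check`, either this derivation or the identity takes `μ` to a
measure whose transform does not vanish at `m`.
-/

/-! ### Operators with vanishing iterated Leibniz defects -/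

section Defects

variable {A : Type*} [CommRing A] [Algebra ℂ A]

/-- All `n`-fold iterated Leibniz defects of `D` vanish. Level `0` is `D = 0` and level `1` is the
Leibniz rule; no continuity is required. -/
def HasVanishingDefects : ℕ → (A →ₗ[ℂ] A) → Prop
  | 0, D => D = 0
  | n + 1, D => ∀ b, HasVanishingDefects n (leibnizDefectLeft D b)

theorem leibnizDefectLeft_apply (D : A →ₗ[ℂ] A) (a b : A) :
    leibnizDefectLeft D b a = D (a * b) - D a * b - a * D b := rfl

theorem leibnizDefectRight_eq_left (D : A →ₗ[ℂ] A) (a : A) :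
    leibnizDefectRight D a = leibnizDefectLeft D a := by
  ext b
  change D (a * b) - D a * b - a * D b = D (b * a) - D b * a - b * D a
  rw [mul_comm b a]
  ring

theorem HasVanishingDefects.zero (n : ℕ) : HasVanishingDefects n (0 : A →ₗ[ℂ] A) := by
  induction n with
  | zero => rfl
  | succ n ih =>
    intro b
    convert ih
    ext a
    simp [leibnizDefectLeft_apply]

theorem HasVanishingDefects.add {n : ℕ} {D E : A →ₗ[ℂ] A} (hD : HasVanishingDefects n D)
    (hE : HasVanishingDefects n E) : HasVanishingDefects n (D + E) := by
  induction n generalizing D E with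
  | zero =>
    change D + E = 0
    rw [show D = 0 from hD, show E = 0 from hE, add_zero]
  | succ n ih =>
    intro b
    convert ih (hD b) (hE b)
    ext a
    simp only [leibnizDefectLeft_apply, LinearMap.add_apply]
    ring

theorem HasVanishingDefects.smul {n : ℕ} {D : A →ₗ[ℂ] A} (hD : HasVanishingDefects n D) (c : ℂ) :
    HasVanishingDefects n (c • D) := by
  induction n generalizing D with
  | zero =>
    change c • D = 0
    rw [show D = 0 from hD, smul_zero]
  | succ n ih =>
    intro b
    convert ih (hD b)
    ext a
    simp [leibnizDefectLeft_apply, smul_sub]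

theorem HasVanishingDefects.mulLeft_comp {n : ℕ} {D : A →ₗ[ℂ] A} (hD : HasVanishingDefects n D)
    (c : A) : HasVanishingDefects n (LinearMap.mulLeft ℂ c ∘ₗ D) := by
  induction n generalizing D with
  | zero =>
    change _ = 0
    rw [show D = 0 from hD, LinearMap.comp_zero]
  | succ n ih =>
    intro b
    convert ih (hD b)
    ext a
    simp only [leibnizDefectLeft_apply, LinearMap.comp_apply, LinearMap.mulLeft_apply]
    ring

theorem HasVanishingDefects.map_mem {n : ℕ} {D : A →ₗ[ℂ] A} (hD : HasVanishingDefects n D)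
    (I : Ideal A) {a : A} (ha : a ∈ I ^ (n + 1)) : D a ∈ I := by
  induction n generalizing D a with
  | zero =>
    rw [show D = 0 from hD]
    exact I.zero_mem
  | succ n ih =>
    rw [pow_succ] at ha
    refine Submodule.mul_induction_on ha (fun x hx y hy => ?_) (fun x y hx hy => ?_)
    · have h : D (x * y) = leibnizDefectLeft D y x + D x * y + x * D y := by
        rw [leibnizDefectLeft_apply]
        ring
      rw [h]
      exact I.add_mem (I.add_mem (ih (hD y) hx) (I.mul_mem_left _ hy))
        (I.mul_mem_right _ (Ideal.pow_le_self n.succ_ne_zero hx))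
    · rw [map_add]
      exact I.add_mem hx hy

variable [TopologicalSpace A]

/-- The property is a system of equations between values of the operator, hence closed under
pointwise limits. -/
theorem isClosed_setOf_hasVanishingDefects [T2Space A] [IsTopologicalAddGroup A]
    [SeparatelyContinuousMul A] {X : Type*} [TopologicalSpace X] {D : X → A →ₗ[ℂ] A}
    (hD : ∀ a, Continuous fun x => D x a) (n : ℕ) :
    IsClosed {x | HasVanishingDefects n (D x)} := by
  induction n generalizing D with
  | zero =>
    have h : {x | HasVanishingDefects 0 (D x)} = ⋂ a, {x | D x a = 0} := by
      ext x
      simp [HasVanishingDefects, LinearMap.ext_iff]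
    rw [h]
    exact isClosed_iInter fun a => isClosed_eq (hD a) continuous_const
  | succ n ih =>
    have h : {x | HasVanishingDefects (n + 1) (D x)} =
        ⋂ b, {x | HasVanishingDefects n (leibnizDefectLeft (D x) b)} := by
      ext x
      simp [HasVanishingDefects]
    rw [h]
    refine isClosed_iInter fun b => ih fun a => ?_
    exact ((hD (a * b)).sub ((hD a).mul_const b)).sub ((hD b).const_mul a)

/-- Continuity of the iterated defects is automatic, multiplication being separately continuous. -/
theorem isDerivationOfOrder_succ_iff [IsTopologicalAddGroup A] [SeparatelyContinuousMul A]
    (n : ℕ) (D : A →ₗ[ℂ] A) :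
    IsDerivationOfOrder (n + 1) D ↔ Continuous D ∧ HasVanishingDefects (n + 1) D := by
  induction n generalizing D with
  | zero =>
    refine and_congr_right fun _ => ⟨fun h b => ?_, fun h a b => ?_⟩
    · ext a
      rw [leibnizDefectLeft_apply, h, LinearMap.zero_apply]
      ring
    · have := LinearMap.congr_fun (h b) a
      rw [leibnizDefectLeft_apply, LinearMap.zero_apply] at this
      linear_combination this
  | succ n ih =>
    simp only [IsDerivationOfOrder, leibnizDefectRight_eq_left, and_self]
    refine and_congr_right fun hc => forall_congr' fun b => ?_
    rw [ih]
    refine and_iff_right ?_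
    exact ((hc.comp (continuous_mul_const b)).sub (hc.mul_const b)).sub (continuous_mul_const _)

theorem IsDerivationOfOrder.map_mem [IsTopologicalAddGroup A] [SeparatelyContinuousMul A]
    {k : ℕ} {D : A →ₗ[ℂ] A} (hD : IsDerivationOfOrder k D) (I : Ideal A) {a : A}
    (ha : a ∈ I ^ (k + 1)) : D a ∈ I := by
  cases k with
  | zero =>
    obtain ⟨c, rfl⟩ := hD
    rw [zero_add, pow_one] at ha
    exact I.smul_of_tower_mem c ha
  | succ k => exact ((isDerivationOfOrder_succ_iff k D).1 hD).2.map_mem I ha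

theorem IsDerivationOfOrder.continuous [ContinuousConstSMul ℂ A] {k : ℕ} {D : A →ₗ[ℂ] A}
    (hD : IsDerivationOfOrder k D) : Continuous D := by
  match k, hD with
  | 0, ⟨c, hc⟩ =>
    rw [hc]
    exact continuous_id.const_smul c
  | 1, h => exact h.1
  | _ + 2, h => exact h.1

end Defects

/-! ### Duality between measures and continuous functions -/

/-- A point outside the weak closure of a subspace is separated from the subspace by one of the
functionals which define the weak topology. -/
theorem WeakBilin.exists_annihilator_of_notMem_closure {E F : Type*} [AddCommGroup E] [Module ℂ E]
    [AddCommGroup F] [Module ℂ F] (B : E →ₗ[ℂ] F →ₗ[ℂ] ℂ) (S : Submodule ℂ (WeakBilin B))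
    {x : WeakBilin B} (hx : x ∉ closure (S : Set (WeakBilin B))) :
    ∃ y : F, (∀ z ∈ S, WeakBilin.eval B y z = 0) ∧ WeakBilin.eval B y x ≠ 0 := by
  obtain ⟨g, u, hg, hu⟩ := RCLike.geometric_hahn_banach_closed_point (𝕜 := ℂ)
    (S.topologicalClosure.restrictScalars ℝ).convex S.isClosed_topologicalClosure hx
  obtain ⟨y, rfl⟩ := LinearMap.dualEmbedding_surjective B g
  have hg' : ∀ z ∈ S, (WeakBilin.eval B y z).re < u :=
    fun z hz => hg z (S.le_topologicalClosure hz)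
  refine ⟨y, fun z hz => ?_, fun h => ?_⟩
  · by_contra hne
    -- A multiple of `z` on which the functional takes the value `u`.
    have h := hg' _ (S.smul_mem ((u : ℂ) / WeakBilin.eval B y z) hz)
    rw [map_smul, smul_eq_mul, div_mul_cancel₀ _ hne, Complex.ofReal_re] at h
    exact lt_irrefl u h
  · have h0 := hg' 0 S.zero_mem
    have h1 : u < (WeakBilin.eval B y x).re := hu
    rw [h] at h1
    rw [map_zero] at h0
    exact lt_asymm h0 h1

namespace MeasureAlgebra

section Topology

variable {G : Type*} [TopologicalSpace G]

instance : IsTopologicalAddGroup (MeasureAlgebra G) :=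
  inferInstanceAs (IsTopologicalAddGroup (WeakDual ℂ C(G, ℂ)))

instance : ContinuousConstSMul ℂ (MeasureAlgebra G) :=
  inferInstanceAs (ContinuousConstSMul ℂ (WeakDual ℂ C(G, ℂ)))

instance : T2Space (MeasureAlgebra G) :=
  inferInstanceAs (T2Space (WeakDual ℂ C(G, ℂ)))

theorem continuous_apply (f : C(G, ℂ)) : Continuous fun μ : MeasureAlgebra G => μ f :=
  WeakDual.eval_continuous f

theorem continuous_of_continuous_apply {X : Type*} [TopologicalSpace X] {F : X → MeasureAlgebra G}
    (h : ∀ f, Continuous fun x => F x f) : Continuous F :=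
  WeakDual.continuous_of_continuous_eval h

theorem exists_annihilator_of_notMem_closure (S : Submodule ℂ (MeasureAlgebra G))
    {μ : MeasureAlgebra G} (hμ : μ ∉ closure (S : Set (MeasureAlgebra G))) :
    ∃ f : C(G, ℂ), (∀ ν ∈ S, ν f = 0) ∧ μ f ≠ 0 := by
  -- `S` as a subspace of the `WeakBilin` space which underlies `MeasureAlgebra G`.
  let S' : Submodule ℂ (WeakBilin (topDualPairing ℂ C(G, ℂ))) :=
    { carrier := (S : Set (MeasureAlgebra G))
      add_mem' := S.add_mem
      zero_mem' := S.zero_mem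
      smul_mem' := fun c _ h => S.smul_mem c h }
  have hS : @closure (WeakBilin (topDualPairing ℂ C(G, ℂ))) _ (S' : Set _) =
      closure (S : Set (MeasureAlgebra G)) := rfl
  obtain ⟨f, hf, hμf⟩ := WeakBilin.exists_annihilator_of_notMem_closure
    (topDualPairing ℂ C(G, ℂ)) S' (x := μ) (hS ▸ hμ)
  exact ⟨f, hf, hμf⟩

theorem mem_closure_span_dirac (μ : MeasureAlgebra G) :
    μ ∈ closure (Submodule.span ℂ (Set.range (dirac (G := G))) : Set (MeasureAlgebra G)) := by
  by_contra hμ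
  obtain ⟨f, hf, hμf⟩ := exists_annihilator_of_notMem_closure _ hμ
  have h : f = 0 := by
    ext x
    exact hf _ (Submodule.subset_span ⟨x, rfl⟩)
  exact hμf (h ▸ μ.map_zero')

protected theorem map_sub' (μ : MeasureAlgebra G) (f g : C(G, ℂ)) : μ (f - g) = μ f - μ g :=
  map_sub μ.toCLM f g

protected theorem sub_apply (μ ν : MeasureAlgebra G) (f : C(G, ℂ)) :
    (μ - ν) f = μ f - ν f := rfl

variable [LocallyCompactSpace G]

/-- The multiplication `μ ↦ p μ` of measures by the continuous function `p`. -/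
noncomputable def mulFun (p : C(G, ℂ)) : MeasureAlgebra G →ₗ[ℂ] MeasureAlgebra G where
  toFun μ := ofCLM (μ.toCLM ∘L ⟨LinearMap.mulLeft ℂ p, continuous_const.mul continuous_id⟩)
  map_add' _ _ := rfl
  map_smul' _ _ := rfl

theorem mulFun_apply (p : C(G, ℂ)) (μ : MeasureAlgebra G) (f : C(G, ℂ)) :
    mulFun p μ f = μ (p * f) := rfl

theorem continuous_mulFun (p : C(G, ℂ)) : Continuous (mulFun p) :=
  continuous_of_continuous_apply fun f => continuous_apply (p * f)

end Topology

end MeasureAlgebra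

/-! ### Generalized polynomials -/

section GenPoly

open MeasureAlgebra

variable {G : Type*} [AddCommGroup G] [TopologicalSpace G] [IsTopologicalAddGroup G]

/-- The translate `x ↦ f (x + y)`. -/
noncomputable def ContinuousMap.translate (y : G) (f : C(G, ℂ)) : C(G, ℂ) := f.comp ⟨(· + y), by fun_prop⟩

@[simp] theorem ContinuousMap.translate_apply (y : G) (f : C(G, ℂ)) (x : G) :
    f.translate y x = f (x + y) := rfl

/-- All `n`-fold differences of the continuous function `p` vanish, that is, `p` is a generalized
polynomial of degree less than `n`. -/
def IsGenPoly : ℕ → C(G, ℂ) → Prop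
  | 0, p => p = 0
  | n + 1, p => ∀ y, IsGenPoly n (p.translate y - p)

theorem IsGenPoly.sub_const {n : ℕ} {p : C(G, ℂ)} (hp : IsGenPoly (n + 1) p) (c : ℂ) :
    IsGenPoly (n + 1) (p - ContinuousMap.const G c) := by
  intro y
  convert hp y using 1
  ext x
  simp

variable [LocallyCompactSpace G]

theorem MeasureAlgebra.mul_dirac_apply (μ : MeasureAlgebra G) (y : G) (f : C(G, ℂ)) :
    (μ * dirac y) f = μ (f.translate y) := rfl

variable [T2Space G]

instance : SeparatelyContinuousMul (MeasureAlgebra G) where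
  continuous_mul_const {ν} := continuous_of_continuous_apply fun f =>
    continuous_apply (ν.partialInt (pullAdd f))
  continuous_const_mul {ν} := by
    simp_rw [mul_comm ν]
    exact continuous_of_continuous_apply fun f => continuous_apply (ν.partialInt (pullAdd f))

/-- The Leibniz defect of multiplication by `p` at the point mass `δ_y` is multiplication by
`x ↦ p (x + y) - p x - p y`, followed by translation. -/
theorem leibnizDefectLeft_mulFun_dirac (p : C(G, ℂ)) (y : G) :
    leibnizDefectLeft (mulFun p) (dirac y) = LinearMap.mulLeft ℂ (dirac y) ∘ₗ
      mulFun (p.translate y - p - ContinuousMap.const G (p y)) := by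
  ext μ f
  have h1 : mulFun p (dirac y) = p y • dirac y := rfl
  have h2 : (p * f).translate y - p * f.translate y - p y • f.translate y =
      (p.translate y - p - ContinuousMap.const G (p y)) * f.translate y := by
    ext x
    simp only [ContinuousMap.sub_apply, ContinuousMap.mul_apply, ContinuousMap.translate_apply,
      ContinuousMap.smul_apply, ContinuousMap.const_apply, smul_eq_mul]
    ring
  rw [leibnizDefectLeft_apply, h1, LinearMap.comp_apply, LinearMap.mulLeft_apply,
    mul_comm (dirac y), mul_dirac_apply, mulFun_apply, ← h2, MeasureAlgebra.map_sub',
    MeasureAlgebra.map_sub', MeasureAlgebra.map_smul', mul_smul_comm, MeasureAlgebra.sub_apply,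
    MeasureAlgebra.sub_apply]
  rfl

theorem hasVanishingDefects_mulFun {n : ℕ} {p : C(G, ℂ)} (hp : IsGenPoly (n + 1) p)
    (h0 : p 0 = 0) : HasVanishingDefects n (mulFun p) := by
  induction n generalizing p with
  | zero =>
    have h : p = 0 := by
      ext y
      have := DFunLike.congr_fun (hp y) 0
      simpa [h0] using this
    ext μ f
    rw [mulFun_apply, h, zero_mul, map_zero']
    rfl
  | succ n ih =>
    intro ν
    -- The set of admissible `ν` is a closed subspace, so point masses suffice.
    have hcl : IsClosed {ν | HasVanishingDefects n (leibnizDefectLeft (mulFun p) ν)} :=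
      isClosed_setOf_hasVanishingDefects (fun μ =>
        (((continuous_mulFun p).comp (continuous_const_mul μ)).sub (continuous_const_mul _)).sub
          ((continuous_mulFun p).const_mul μ)) n
    refine closure_minimal (fun ν hν => ?_) hcl (mem_closure_span_dirac ν)
    refine Submodule.span_induction (p := fun ν _ =>
      HasVanishingDefects n (leibnizDefectLeft (mulFun p) ν)) ?_ ?_ ?_ ?_ hν
    · rintro _ ⟨y, rfl⟩
      rw [leibnizDefectLeft_mulFun_dirac]
      refine (ih ((hp y).sub_const (p y)) ?_).mulLeft_comp _
      simp [h0]
    · convert HasVanishingDefects.zero n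
      ext1 μ
      simp [leibnizDefectLeft_apply]
    · intro ν ρ _ _ h1 h2
      convert h1.add h2
      ext1 μ
      simp only [leibnizDefectLeft_apply, LinearMap.add_apply, mul_add, map_add]
      ring
    · intro c ν _ h
      convert h.smul c
      ext1 μ
      simp [leibnizDefectLeft_apply, smul_sub]

end GenPoly

/-! ### Exponentials and powers of the exponential maximal ideal -/

section Exponential

open MeasureAlgebra

variable {G : Type*} [AddCommGroup G] [TopologicalSpace G] [IsTopologicalAddGroup G]

theorem Exponential.check_apply_add (m : Exponential G) (x y : G) :
    m.check (x + y) = m.check x * m.check y := by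
  simp [Exponential.check, ofAdd_add, mul_comm]

theorem Exponential.check_apply_zero (m : Exponential G) : m.check 0 = 1 := by
  simp [Exponential.check]

theorem Exponential.check_apply_ne_zero (m : Exponential G) (x : G) : m.check x ≠ 0 :=
  Units.ne_zero _

variable [LocallyCompactSpace G] [T2Space G]

theorem fourierLaplace_apply (μ : MeasureAlgebra G) (m : Exponential G) :
    fourierLaplace μ m = μ m.check := rfl

theorem mem_exponentialMaximalIdeal_iff (m : Exponential G) (μ : MeasureAlgebra G) :
    μ ∈ exponentialMaximalIdeal m ↔ μ m.check = 0 := Iff.rfl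

theorem smul_dirac_sub_one_mem_exponentialMaximalIdeal (m : Exponential G) (y : G) :
    (m.check y)⁻¹ • dirac y - 1 ∈ exponentialMaximalIdeal m := by
  rw [mem_exponentialMaximalIdeal_iff, MeasureAlgebra.sub_apply, MeasureAlgebra.smul_apply,
    dirac_apply, MeasureAlgebra.one_apply, m.check_apply_zero,
    inv_mul_cancel₀ (m.check_apply_ne_zero y), sub_self]

/-- Multiplying by `(m.check y)⁻¹ • dirac y - 1`, an element of the ideal, amounts to taking the
difference of `p` with step `y`. -/
theorem isGenPoly_of_annihilates (m : Exponential G) {n : ℕ} {p : C(G, ℂ)}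
    (hp : ∀ ν ∈ exponentialMaximalIdeal m ^ n, ν (p * m.check) = 0) : IsGenPoly n p := by
  induction n generalizing p with
  | zero =>
    ext x
    have := hp (dirac x) (by simp)
    exact (mul_eq_zero.1 this).resolve_right (m.check_apply_ne_zero x)
  | succ n ih =>
    refine fun y => ih fun ν hν => ?_
    have h := hp (ν * ((m.check y)⁻¹ • dirac y - 1)) (by
      rw [pow_succ]
      exact Ideal.mul_mem_mul hν (smul_dirac_sub_one_mem_exponentialMaximalIdeal m y))
    have h1 : (p.translate y - p) * m.check =
        (m.check y)⁻¹ • (p * m.check).translate y - p * m.check := by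
      ext x
      simp only [ContinuousMap.sub_apply, ContinuousMap.mul_apply, ContinuousMap.smul_apply,
        ContinuousMap.translate_apply, m.check_apply_add, smul_eq_mul]
      field_simp [m.check_apply_ne_zero y]
    rw [mul_sub, mul_one, mul_smul_comm, MeasureAlgebra.sub_apply, MeasureAlgebra.smul_apply,
      mul_dirac_apply] at h
    rwa [h1, MeasureAlgebra.map_sub', MeasureAlgebra.map_smul']

end Exponential

/-! ### Closed powers and derivations -/

theorem mainTheorem4 {G : Type*} [AddCommGroup G] [TopologicalSpace G] [IsTopologicalAddGroup G]
    [LocallyCompactSpace G] [T2Space G] (m : Exponential G) (n : ℕ) (μ : MeasureAlgebra G) :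
    μ ∈ closure ((exponentialMaximalIdeal m ^ (n + 1) : Ideal (MeasureAlgebra G)) :
        Set (MeasureAlgebra G)) ↔
      ∀ D : MeasureAlgebra G →ₗ[ℂ] MeasureAlgebra G, IsDerivationOfOrderAtMost n D →
        fourierLaplace (D μ) m = 0 := by
  constructor
  · rintro hμ D ⟨k, hk, hD⟩
    have hcl : IsClosed {ν | fourierLaplace (D ν) m = 0} :=
      isClosed_eq ((MeasureAlgebra.continuous_apply m.check).comp hD.continuous) continuous_const
    refine closure_minimal (fun ν hν => ?_) hcl hμ
    exact hD.map_mem _ (Ideal.pow_le_pow_right (by omega) hν)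
  · intro h
    by_contra hμ
    obtain ⟨f, hf, hμf⟩ := MeasureAlgebra.exists_annihilator_of_notMem_closure
      ((exponentialMaximalIdeal m ^ (n + 1)).restrictScalars ℂ) hμ
    let p : C(G, ℂ) := ⟨fun x => f x / m.check x,
      f.continuous.div₀ m.check.continuous m.check_apply_ne_zero⟩
    have hpf : p * m.check = f := by
      ext x
      exact div_mul_cancel₀ _ (m.check_apply_ne_zero x)
    have hp : IsGenPoly (n + 1) (p - ContinuousMap.const G (p 0)) := by
      refine (isGenPoly_of_annihilates m fun ν hν => ?_).sub_const (p 0)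
      rw [hpf]
      exact hf ν hν
    have hD := hasVanishingDefects_mulFun hp (by simp)
    have hD' : IsDerivationOfOrder n
        (MeasureAlgebra.mulFun (p - ContinuousMap.const G (p 0))) := by
      cases n with
      -- Here `p` is constant and the operator vanishes.
      | zero => exact ⟨0, by rw [zero_smul]; exact hD⟩
      | succ n => exact (isDerivationOfOrder_succ_iff n _).2 ⟨MeasureAlgebra.continuous_mulFun _, hD⟩
    have h1 := h _ ⟨n, le_rfl, hD'⟩
    have h2 := h LinearMap.id ⟨0, n.zero_le, 1, (one_smul _ _).symm⟩
    rw [fourierLaplace_apply, MeasureAlgebra.mulFun_apply] at h1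
    rw [fourierLaplace_apply, LinearMap.id_apply] at h2
    have h3 : f = (p - ContinuousMap.const G (p 0)) * m.check + p 0 • m.check := by
      rw [← hpf]
      ext x
      simp only [ContinuousMap.add_apply, ContinuousMap.sub_apply, ContinuousMap.mul_apply,
        ContinuousMap.smul_apply, ContinuousMap.const_apply, smul_eq_mul]
      ring
    apply hμf
    rw [h3, MeasureAlgebra.map_add', MeasureAlgebra.map_smul', h1, h2, mul_zero, add_zero]
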